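/- Let $d\in\mathbb N$, $K,K'\in\mathbb R$, $\bar C>0$, $\alpha\in(0,1)$, $T>0$, $\bar\epsilon>0$, $\theta^*\in\mathbb R^d$ and a function $R\mapsto C_R$ be given. Then there are constants $c,\hat C,\eta>0$, depending only on these data, such that the following holds. Let $\Pi_\theta(x;dy)$ be a Markov transition kernel on $\mathbb R^d$, jointly measurable in $(\theta,x)$, that for every $\theta\in\mathbb R^d$ has a unique invariant probability measure $\Gamma_\theta$. Let $f:\mathbb R^d\times\mathbb R^d\to\mathbb R^d$ be measurable with $\|f(\theta,y)\|\le K(1+\|\theta\|)$ for all $\theta,y$ ($\|\cdot\|$ is the Euclidean norm), and put $u(\theta)=\int f(\theta,y)\,\Gamma_\theta(dy)$. Suppose that for every $\theta$ the Poisson equation $v_\theta(x)-\int v_\theta(y)\,\Pi_\theta(x;dy)=f(\theta,x)-u(\theta)$ ($x\in\mathbb R^d$) has a measurable solution $v_\theta$, integrable with respect to every $\Pi_\theta(x;\cdot)$, and that for all $R>0$ we have $C_R>0$, $\|v_\theta(x)\|\le C_R(1+\|x\|)$ and $\|v_\theta(x)-v_{\theta'}(x)\|\le C_R\|\theta-\theta'\|(1+\|x\|)$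 whenever $\|\theta\|,\|\theta'\|\le R$, $x\in\mathbb R^d$. Suppose $\|u(\theta)-u(\theta')\|\le\alpha\|\theta-\theta'\|$ for all $\theta,\theta'$, and $u(\theta^*)=\theta^*$. Let $(a(n))_{n\ge0}$ be positive and non-increasing with $\sum_n a(n)=\infty$ and $\sum_n a(n)^2<\infty$, and put $s(n)=\sum_{m\ge n}a(m)^2$. On a probability space with a filtration $(\mathcal F_n)$, consider the stochastic fixed point iteration $$\theta_{n+1}=\theta_n+a(n)\bigl[f(\theta_n,Y_n)-\theta_n+M_{n+1}\bigr],\qquad n\ge0,$$ where $\theta_n,Y_n,M_n$ are $\mathbb R^d$-valued, $\theta_n,Y_n$ are $\mathcal F_n$-measurable and $M_{n+1}$ is $\mathcal F_{n+1}$-measurable; $P[Y_{n+1}\in A\mid\mathcal F_n]=\Pi_{\theta_n}(Y_n;A)$ a.s. for every Borel set $A$; $M_{n+1}$ is integrable, $E[M_{n+1}\mid\mathcal F_n]=0$ a.s. and $\|M_{n+1}\|\le K'(1+\|\theta_n\|)$ a.s.; and, for some deterministic index $n_1$, $\|Y_n\|\le\bar C$ a.s. for all $n\ge n_1$. Let $0<\epsilon\le\bar\epsilon$,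 $0<\gamma<1$, $B=\{\theta:\|\theta-\theta^*\|<\tfrac{3\epsilon}{2}\}$, and let $n_0\ge n_1$ be so large that $$a(n_0)<\eta\epsilon,\quad s(n_0)<\eta\epsilon,\quad s(n_0)<\frac{\hat C\epsilon^2}{4},\quad a(n_0)<\frac{\hat C\epsilon^2}{4},\quad s(n_0)<\frac{c\,\epsilon^2}{\ln(4d/\gamma)}.$$ Put $$N_0=\min\Bigl\{n:\ \sum_{i=n_0+1}^{n}a(i)\ \ge\ \frac{T+1}{1-e^{-(1-\alpha)T}}\Bigr\}-n_0 .$$ If $P(\theta_{n_0}\in B)>0$, then $$P\bigl(\|\theta_n-\theta^*\|<2\epsilon\ \text{ for all } n\ge n_0+N_0\ \big|\ \theta_{n_0}\in B\bigr)\ \ge\ 1-\gamma .$$ -/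

import Mathlib

open MeasureTheory ProbabilityTheory

/-- The state space `ℝ^d` with its Euclidean norm. -/
abbrev Vec (d : ℕ) : Type := EuclideanSpace ℝ (Fin d)

/-- Step sizes: positive, non-increasing, `∑ a(n) = ∞` and `∑ a(n)^2 < ∞`. -/
structure IsStepSize (a : ℕ → ℝ) : Prop where
  pos : ∀ n, 0 < a n
  antitone : Antitone a
  sum_diverges : ¬ Summable a
  sum_sq_converges : Summable (fun n => a n ^ 2)

/-- `s(n) = ∑_{m ≥ n} a(m)^2`. -/
noncomputable def tailSq (a : ℕ → ℝ) (n : ℕ) : ℝ := ∑' m : ℕ, a (n + m) ^ 2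

/-- The averaged map `u(θ) = ∫ f(θ, y) Γ_θ(dy)`. -/
noncomputable def avgMap {d : ℕ} (f : Vec d → Vec d → Vec d) (Γ : Vec d → Measure (Vec d))
    (θ : Vec d) : Vec d :=
  ∫ y, f θ y ∂(Γ θ)

/-- The assumptions on the deterministic data of the recursion.
`κ (θ, x)` is the transition probability `Π_θ(x; dy)`, `Γ θ` its stationary law, `v θ` the solution
of the Poisson equation `(1 - Π_θ) v_θ = f(θ, ·) - ∫ f(θ, y) Γ_θ(dy)`. -/
structure IsNoiseModel {d : ℕ} (f : Vec d → Vec d → Vec d) (κ : Kernel (Vec d × Vec d) (Vec d))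
    (Γ : Vec d → Measure (Vec d)) (v : Vec d → Vec d → Vec d) (K : ℝ) (CR : ℝ → ℝ) : Prop where
  measurable_f : Measurable (fun p : Vec d × Vec d => f p.1 p.2)
  growth_f : ∀ θ y, ‖f θ y‖ ≤ K * (1 + ‖θ‖)
  markov : IsMarkovKernel κ
  prob : ∀ θ, IsProbabilityMeasure (Γ θ)
  invariant : ∀ θ, (κ.sectR θ).Invariant (Γ θ)
  unique : ∀ θ (ν : Measure (Vec d)), IsProbabilityMeasure ν → (κ.sectR θ).Invariant ν → ν = Γ θ
  measurable_v : ∀ θ, Measurable (v θ)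
  integrable_v : ∀ θ x, Integrable (v θ) (κ (θ, x))
  poisson : ∀ θ x, v θ x - ∫ y, v θ y ∂(κ (θ, x)) = f θ x - avgMap f Γ θ
  const_pos : ∀ R, 0 < R → 0 < CR R
  growth_v : ∀ R, 0 < R → ∀ θ, ‖θ‖ ≤ R → ∀ x, ‖v θ x‖ ≤ CR R * (1 + ‖x‖)
  lipschitz_v : ∀ R, 0 < R → ∀ θ θ', ‖θ‖ ≤ R → ‖θ'‖ ≤ R → ∀ x,
    ‖v θ x - v θ' x‖ ≤ CR R * ‖θ - θ'‖ * (1 + ‖x‖)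

/-- The stochastic fixed point iteration
`θ_{n+1} = θ_n + a(n) (f(θ_n, Y_n) - θ_n + M_{n+1})`, driven by Markov iterate-dependent noise `Y`
with transition probabilities `κ` and by martingale difference noise `M`; from the index `n₁` on
the noise `Y` lives in the ball of radius `Cbar`. -/
structure IsFixedPointIteration {d : ℕ} {Ω : Type*} [MeasurableSpace Ω] (μ : Measure Ω)
    (ℱ : Filtration ℕ (inferInstance : MeasurableSpace Ω))
    (a : ℕ → ℝ) (f : Vec d → Vec d → Vec d) (κ : Kernel (Vec d × Vec d) (Vec d))
    (θ Y M : ℕ → Ω → Vec d) (K' Cbar : ℝ) (n₁ : ℕ) : Prop where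
  measurable_θ : ∀ n, Measurable[ℱ n] (θ n)
  measurable_Y : ∀ n, Measurable[ℱ n] (Y n)
  measurable_M : ∀ n, Measurable[ℱ (n + 1)] (M (n + 1))
  recursion : ∀ n ω, θ (n + 1) ω = θ n ω + a n • (f (θ n ω) (Y n ω) - θ n ω + M (n + 1) ω)
  transition : ∀ n (A : Set (Vec d)), MeasurableSet A →
    μ⟦Y (n + 1) ⁻¹' A | ℱ n⟧ =ᵐ[μ] fun ω => (κ (θ n ω, Y n ω)).real A
  bounded_Y : ∀ n, n₁ ≤ n → ∀ᵐ ω ∂μ, ‖Y n ω‖ ≤ Cbar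
  integrable_M : ∀ n, Integrable (M (n + 1)) μ
  martingale_M : ∀ n, μ[M (n + 1) | ℱ n] =ᵐ[μ] 0
  bounded_M : ∀ n, ∀ᵐ ω ∂μ, ‖M (n + 1) ω‖ ≤ K' * (1 + ‖θ n ω‖)

/-- `N₀ = min {n : ∑_{i=n₀+1}^n a(i) ≥ (T + 1) / (1 - e^{-(1-α)T})} - n₀`. -/
noncomputable def sampleComplexity (a : ℕ → ℝ) (α T : ℝ) (n₀ : ℕ) : ℕ :=
  sInf {n : ℕ | (T + 1) / (1 - Real.exp (-(1 - α) * T)) ≤ ∑ i ∈ Finset.Icc (n₀ + 1) n, a i} - n₀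

/-! The Poisson solution `v` splits the noise f(θ_n,Y_n) - u(θ_n) + M_{n+1} into a martingale
difference (`martingaleNoise`) and a correction v_{θ_n}(Y_n) - v_{θ_n}(Y_{n+1}). Weighted by the
step sizes, the correction almost telescopes: summation by parts leaves boundary terms of order
a(n₀) and, as v is Lipschitz in θ, a remainder of order s(n₀) (`norm_sum_poissonCorrection_le`). The
martingale part is bounded at all times simultaneously by Azuma combined with Doob, with variance
proxy L² s(n₀) (`cond_measure_martingaleNoise_le`).

If each part stays below (1-α)ε/8, the rest is deterministic (`norm_iterate_sub_lt`): the iterate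
minus its accumulated noise moves by convex combinations inside the closed 3ε/2-ball, so the iterate
stays within 2ε.

The noise bounds hold only while the iterates are bounded. Hence the martingale is stopped on
leaving the 2ε-ball; until then the stopped and true sums agree, which closes the induction. The
iterates then stay within 2ε from n₀ on, which is more than required. -/

section Azuma

/-! ### Scalar Azuma inequality. -/

variable {Ω : Type*} [mΩ : MeasurableSpace Ω] {ν : Measure Ω}
  {𝒢 : Filtration ℕ mΩ} {D : ℕ → Ω → ℝ} {b : ℕ → ℝ}

lemma stronglyMeasurable_partialSum
    (hmeas : ∀ k, StronglyMeasurable[𝒢 (k + 1)] (D k)) (n : ℕ) :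
    StronglyMeasurable[𝒢 n] (fun ω => ∑ k ∈ Finset.range n, D k ω) :=
  Finset.stronglyMeasurable_fun_sum _ fun k hk =>
    (hmeas k).mono (𝒢.mono (Finset.mem_range.1 hk))

lemma stronglyMeasurable_exp_partialSum
    (hmeas : ∀ k, StronglyMeasurable[𝒢 (k + 1)] (D k)) (t : ℝ) (n : ℕ) :
    StronglyMeasurable[𝒢 n] (fun ω => Real.exp (t * ∑ k ∈ Finset.range n, D k ω)) :=
  Real.continuous_exp.comp_stronglyMeasurable
    ((stronglyMeasurable_partialSum hmeas n).const_mul t)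

lemma exp_partialSum_bound (hbd : ∀ k, ∀ᵐ ω ∂ν, |D k ω| ≤ b k) (t : ℝ) (n : ℕ) :
    ∀ᵐ ω ∂ν, ‖Real.exp (t * ∑ k ∈ Finset.range n, D k ω)‖
      ≤ Real.exp (|t| * ∑ k ∈ Finset.range n, b k) := by
  filter_upwards [ae_all_iff.2 hbd] with ω hω
  rw [Real.norm_eq_abs, Real.abs_exp]
  refine Real.exp_le_exp.2 ((le_abs_self _).trans ?_)
  rw [abs_mul]
  gcongr
  exact (Finset.abs_sum_le_sum_abs _ _).trans (Finset.sum_le_sum fun k _ => hω k)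

variable [IsProbabilityMeasure ν]

lemma integrable_exp_partialSum (hmeas : ∀ k, StronglyMeasurable[𝒢 (k + 1)] (D k))
    (hbd : ∀ k, ∀ᵐ ω ∂ν, |D k ω| ≤ b k) (t : ℝ) (n : ℕ) :
    Integrable (fun ω => Real.exp (t * ∑ k ∈ Finset.range n, D k ω)) ν :=
  Integrable.of_bound
    ((stronglyMeasurable_exp_partialSum hmeas t n).mono (𝒢.le n)).aestronglyMeasurable _
    (exp_partialSum_bound hbd t n)

lemma integrable_increment (hmeas : ∀ k, StronglyMeasurable[𝒢 (k + 1)] (D k))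
    (hbd : ∀ k, ∀ᵐ ω ∂ν, |D k ω| ≤ b k) (n : ℕ) : Integrable (D n) ν :=
  Integrable.of_bound ((hmeas n).mono (𝒢.le _)).aestronglyMeasurable _ (hbd n)

lemma integrable_exp_partialSum_mul (hmeas : ∀ k, StronglyMeasurable[𝒢 (k + 1)] (D k))
    (hbd : ∀ k, ∀ᵐ ω ∂ν, |D k ω| ≤ b k) (t : ℝ) (n : ℕ) :
    Integrable (fun ω => Real.exp (t * ∑ k ∈ Finset.range n, D k ω) * D n ω) ν :=
  (integrable_increment hmeas hbd n).bdd_mul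
    ((stronglyMeasurable_exp_partialSum hmeas t n).mono (𝒢.le n)).aestronglyMeasurable
    (exp_partialSum_bound hbd t n)

lemma condExp_exp_partialSum_mul (hmeas : ∀ k, StronglyMeasurable[𝒢 (k + 1)] (D k))
    (hbd : ∀ k, ∀ᵐ ω ∂ν, |D k ω| ≤ b k) (hzero : ∀ k, ν[D k | 𝒢 k] =ᵐ[ν] 0) (t : ℝ) (n : ℕ) :
    ν[fun ω => Real.exp (t * ∑ k ∈ Finset.range n, D k ω) * D n ω | 𝒢 n] =ᵐ[ν] 0 := by
  have h := condExp_mul_of_stronglyMeasurable_left (μ := ν)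
    (stronglyMeasurable_exp_partialSum hmeas t n)
    (integrable_exp_partialSum_mul hmeas hbd t n) (integrable_increment hmeas hbd n)
  refine h.trans ?_
  filter_upwards [hzero n] with ω hω
  simp [hω]

/-- From 1 + x ≤ e^x: the linear term has zero conditional mean. This is what makes Doob's
inequality applicable. -/
lemma submartingale_exp_partialSum (hmeas : ∀ k, StronglyMeasurable[𝒢 (k + 1)] (D k))
    (hbd : ∀ k, ∀ᵐ ω ∂ν, |D k ω| ≤ b k) (hzero : ∀ k, ν[D k | 𝒢 k] =ᵐ[ν] 0) (t : ℝ) :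
    Submartingale (fun n ω => Real.exp (t * ∑ k ∈ Finset.range n, D k ω)) 𝒢 ν := by
  refine submartingale_nat (stronglyMeasurable_exp_partialSum hmeas t)
    (integrable_exp_partialSum hmeas hbd t) fun n => ?_
  have hi := integrable_exp_partialSum (ν := ν) hmeas hbd t n
  have him := integrable_exp_partialSum_mul (ν := ν) hmeas hbd t n
  have h1 : ν[(fun ω => Real.exp (t * ∑ k ∈ Finset.range n, D k ω)) +
      t • (fun ω => Real.exp (t * ∑ k ∈ Finset.range n, D k ω) * D n ω) | 𝒢 n] ≤ᵐ[ν]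
      ν[fun ω => Real.exp (t * ∑ k ∈ Finset.range (n + 1), D k ω) | 𝒢 n] := by
    refine condExp_mono (hi.add (him.smul t)) (integrable_exp_partialSum hmeas hbd t (n + 1))
      (ae_of_all _ fun ω => ?_)
    simp only [Pi.add_apply, Pi.smul_apply, smul_eq_mul, Finset.sum_range_succ, mul_add,
      Real.exp_add]
    have := Real.add_one_le_exp (t * D n ω)
    nlinarith [Real.exp_pos (t * ∑ k ∈ Finset.range n, D k ω)]
  have h2 := condExp_add hi (him.smul t) (𝒢 n)
  have h3 := condExp_smul (μ := ν) t
    (fun ω => Real.exp (t * ∑ k ∈ Finset.range n, D k ω) * D n ω) (𝒢 n)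
  have h4 := condExp_of_stronglyMeasurable (𝒢.le n)
    (stronglyMeasurable_exp_partialSum hmeas t n) hi
  filter_upwards [h1, h2, h3, condExp_exp_partialSum_mul hmeas hbd hzero t n] with ω e1 e2 e3 e5
  rw [e2, Pi.add_apply, e3, h4, Pi.smul_apply, e5] at e1
  simpa using e1

/-- By convexity, exp lies below its chord on [-t b, t b]. The linear part of the chord integrates
to zero, and the constant part is cosh(t b) ≤ exp(t² b² / 2). -/
lemma integral_exp_partialSum_le (hmeas : ∀ k, StronglyMeasurable[𝒢 (k + 1)] (D k))
    (hb : ∀ k, 0 < b k)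
    (hbd : ∀ k, ∀ᵐ ω ∂ν, |D k ω| ≤ b k) (hzero : ∀ k, ν[D k | 𝒢 k] =ᵐ[ν] 0) (t : ℝ) (n : ℕ) :
    ∫ ω, Real.exp (t * ∑ k ∈ Finset.range n, D k ω) ∂ν
      ≤ Real.exp (t ^ 2 / 2 * ∑ k ∈ Finset.range n, b k ^ 2) := by
  induction n with
  | zero => simp
  | succ n ih =>
    have hi := integrable_exp_partialSum (ν := ν) hmeas hbd t n
    have him := integrable_exp_partialSum_mul (ν := ν) hmeas hbd t n
    have h0 : ∫ ω, Real.exp (t * ∑ k ∈ Finset.range n, D k ω) * D n ω ∂ν = 0 := by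
      rw [← integral_condExp (𝒢.le n),
        integral_congr_ae (condExp_exp_partialSum_mul hmeas hbd hzero t n)]
      simp
    calc ∫ ω, Real.exp (t * ∑ k ∈ Finset.range (n + 1), D k ω) ∂ν
        ≤ ∫ ω, (Real.exp (t * ∑ k ∈ Finset.range n, D k ω) * Real.cosh (t * b n) +
            Real.exp (t * ∑ k ∈ Finset.range n, D k ω) * D n ω
              * (Real.sinh (t * b n) / b n)) ∂ν := by
          refine integral_mono_ae (integrable_exp_partialSum hmeas hbd t (n + 1))
            ((hi.mul_const _).add (him.mul_const _)) ?_
          filter_upwards [hbd n] with ω hω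
          have hle : |D n ω / b n| ≤ 1 := by
            rw [abs_div, abs_of_pos (hb n)]
            exact (div_le_one (hb n)).2 hω
          have h := Real.exp_mul_le_cosh_add_mul_sinh hle (t * b n)
          have e : D n ω / b n * (t * b n) = t * D n ω := by
            field_simp [(hb n).ne']
          rw [e] at h
          simp only [Finset.sum_range_succ, mul_add, Real.exp_add]
          calc _ ≤ Real.exp (t * ∑ k ∈ Finset.range n, D k ω) *
                (Real.cosh (t * b n) + D n ω / b n * Real.sinh (t * b n)) := by gcongr
            _ = _ := by ring
      _ = (∫ ω, Real.exp (t * ∑ k ∈ Finset.range n, D k ω) ∂ν) * Real.cosh (t * b n) := by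
          rw [integral_add (hi.mul_const _) (him.mul_const _), integral_mul_const,
            integral_mul_const, h0]
          simp
      _ ≤ Real.exp (t ^ 2 / 2 * ∑ k ∈ Finset.range n, b k ^ 2)
            * Real.exp ((t * b n) ^ 2 / 2) := by
          gcongr
          exact Real.cosh_le_exp_half_sq _
      _ = _ := by
          rw [← Real.exp_add, Finset.sum_range_succ]
          congr 1
          ring

/-- Azuma's maximal inequality: one-sided, over an infinite horizon. -/
theorem measure_exists_partialSum_ge_le (hmeas : ∀ k, StronglyMeasurable[𝒢 (k + 1)] (D k))
    (hb : ∀ k, 0 < b k)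
    (hbd : ∀ k, ∀ᵐ ω ∂ν, |D k ω| ≤ b k) (hzero : ∀ k, ν[D k | 𝒢 k] =ᵐ[ν] 0)
    {δ V : ℝ} (hδ : 0 < δ) (hV : 0 < V) (hbV : ∀ n, ∑ k ∈ Finset.range n, b k ^ 2 ≤ V) :
    ν {ω | ∃ n, δ ≤ ∑ k ∈ Finset.range n, D k ω}
      ≤ ENNReal.ofReal (Real.exp (-(δ ^ 2 / (2 * V)))) := by
  -- This `t` minimizes the Chernoff exponent t²V/2 - tδ.
  set t : ℝ := δ / V with ht
  have htpos : 0 < t := div_pos hδ hV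
  -- Doob's inequality has a finite horizon; the bound is uniform in it and passes to the increasing
  -- union.
  have hset : {ω | ∃ n, δ ≤ ∑ k ∈ Finset.range n, D k ω} =
      ⋃ n, {ω | ∃ j ≤ n, δ ≤ ∑ k ∈ Finset.range j, D k ω} := by
    ext ω
    simp only [Set.mem_ofPred_eq, Set.mem_iUnion]
    exact ⟨fun ⟨n, h⟩ => ⟨n, n, le_rfl, h⟩, fun ⟨_, j, _, h⟩ => ⟨j, h⟩⟩
  have hmono : Monotone fun n => {ω | ∃ j ≤ n, δ ≤ ∑ k ∈ Finset.range j, D k ω} :=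
    fun n m hnm ω ⟨j, hj, h⟩ => ⟨j, hj.trans hnm, h⟩
  rw [hset, hmono.measure_iUnion]
  refine iSup_le fun n => ?_
  have hmax := maximal_ineq (submartingale_exp_partialSum hmeas hbd hzero t)
    (fun _ _ => (Real.exp_pos _).le) (ε := (Real.exp (t * δ)).toNNReal) n
  have hcoe : ((Real.exp (t * δ)).toNNReal : ℝ) = Real.exp (t * δ) :=
    Real.coe_toNNReal _ (Real.exp_pos _).le
  rw [hcoe] at hmax
  have hsub : {ω | ∃ j ≤ n, δ ≤ ∑ k ∈ Finset.range j, D k ω} ⊆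
      {ω | Real.exp (t * δ) ≤ (Finset.range (n + 1)).sup' Finset.nonempty_range_add_one
        fun k => Real.exp (t * ∑ i ∈ Finset.range k, D i ω)} := by
    rintro ω ⟨j, hj, h⟩
    have hj' : j ∈ Finset.range (n + 1) := Finset.mem_range.2 (Nat.lt_succ_of_le hj)
    rw [Set.mem_ofPred_eq, Finset.le_sup'_iff]
    refine ⟨j, hj', ?_⟩
    exact Real.exp_le_exp.2 (by gcongr)
  have hint : ∫ ω in {ω | Real.exp (t * δ) ≤ (Finset.range (n + 1)).sup'
        Finset.nonempty_range_add_one fun k => Real.exp (t * ∑ i ∈ Finset.range k, D i ω)},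
      Real.exp (t * ∑ i ∈ Finset.range n, D i ω) ∂ν ≤ Real.exp (t ^ 2 / 2 * V) :=
    (setIntegral_le_integral (integrable_exp_partialSum hmeas hbd t n)
      (ae_of_all _ fun _ => (Real.exp_pos _).le)).trans
      ((integral_exp_partialSum_le hmeas hb hbd hzero t n).trans
        (Real.exp_le_exp.2 (by gcongr; exact hbV n)))
  have h1 : ENNReal.ofReal (Real.exp (t * δ)) *
      ν {ω | ∃ j ≤ n, δ ≤ ∑ k ∈ Finset.range j, D k ω}
      ≤ ENNReal.ofReal (Real.exp (t ^ 2 / 2 * V)) :=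
    (mul_le_mul_right (measure_mono hsub) _).trans
      (hmax.trans (ENNReal.ofReal_le_ofReal hint))
  have h2 : Real.exp (-(δ ^ 2 / (2 * V))) = Real.exp (t ^ 2 / 2 * V) / Real.exp (t * δ) := by
    rw [← Real.exp_sub, ht]
    congr 1
    field_simp
    ring
  rw [h2, ENNReal.ofReal_div_of_pos (Real.exp_pos _),
    ENNReal.le_div_iff_mul_le (Or.inl (by simp [Real.exp_pos])) (Or.inl ENNReal.ofReal_ne_top),
    mul_comm]
  exact h1

end Azuma

/-! ### Vector-valued Azuma inequality. -/

lemma exists_coord_ge {d : ℕ} {x : Vec d} {δ : ℝ} (hδ : 0 < δ) (h : δ ≤ ‖x‖) :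
    ∃ i, δ / √d ≤ |x i| := by
  by_contra! hlt
  have hd : 0 < d := by
    rcases Nat.eq_zero_or_pos d with rfl | hd
    · rw [Subsingleton.elim x 0, norm_zero] at h
      exact absurd h hδ.not_ge
    · exact hd
  have hd' : (0 : ℝ) < d := Nat.cast_pos.2 hd
  have : Nonempty (Fin d) := ⟨⟨0, hd⟩⟩
  have h1 : ‖x‖ ^ 2 < ∑ _i : Fin d, (δ / √d) ^ 2 := by
    rw [EuclideanSpace.norm_sq_eq]
    refine Finset.sum_lt_sum_of_nonempty Finset.univ_nonempty fun i _ => ?_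
    rw [Real.norm_eq_abs]
    exact pow_lt_pow_left₀ (hlt i) (abs_nonneg _) two_ne_zero
  rw [Finset.sum_const, Finset.card_univ, Fintype.card_fin, nsmul_eq_mul, div_pow,
    Real.sq_sqrt hd'.le, mul_div_cancel₀ _ hd'.ne'] at h1
  exact absurd (pow_le_pow_left₀ hδ.le h 2) h1.not_ge

/-- Azuma's maximal inequality for vector-valued martingale differences. -/
theorem measure_exists_norm_partialSum_ge_le {d : ℕ} {Ω : Type*} [mΩ : MeasurableSpace Ω]
    {ν : Measure Ω} [IsProbabilityMeasure ν] {𝒢 : Filtration ℕ mΩ} {D : ℕ → Ω → Vec d} {b : ℕ → ℝ}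
    (hmeas : ∀ k, Measurable[𝒢 (k + 1)] (D k)) (hb : ∀ k, 0 < b k)
    (hbd : ∀ k, ∀ᵐ ω ∂ν, ‖D k ω‖ ≤ b k) (hzero : ∀ k, ν[D k | 𝒢 k] =ᵐ[ν] 0)
    {δ V : ℝ} (hδ : 0 < δ) (hV : 0 < V) (hbV : ∀ n, ∑ k ∈ Finset.range n, b k ^ 2 ≤ V) :
    ν {ω | ∃ n, δ ≤ ‖∑ k ∈ Finset.range n, D k ω‖}
      ≤ ENNReal.ofReal (2 * d * Real.exp (-(δ ^ 2 / (2 * d * V)))) := by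
  have hD : ∀ k, Integrable (D k) ν := fun k =>
    Integrable.of_bound ((hmeas k).mono (𝒢.le _) le_rfl).aestronglyMeasurable _ (hbd k)
  -- The sign `s` covers both tails, so a union bound over 2d scalar events suffices.
  have hcoord : ∀ (s : ℝ), |s| = 1 → ∀ i : Fin d,
      ν {ω | ∃ n, δ / √d ≤ ∑ k ∈ Finset.range n, s * D k ω i}
        ≤ ENNReal.ofReal (Real.exp (-(δ ^ 2 / (2 * d * V)))) := by
    intro s hs i
    have hd : (0 : ℝ) < d := Nat.cast_pos.2 (Fin.pos i)
    let l : Vec d →L[ℝ] ℝ := s • EuclideanSpace.proj i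
    have hl : ∀ k, (fun ω => s * D k ω i) = l ∘ D k := fun k => rfl
    have h := measure_exists_partialSum_ge_le (ν := ν) (𝒢 := 𝒢) (D := fun k ω => s * D k ω i)
      (b := b) (δ := δ / √d) (V := V)
      (fun k => by rw [hl]; exact (l.measurable.comp (hmeas k)).stronglyMeasurable) hb
      (fun k => by
        filter_upwards [hbd k] with ω hω
        rw [abs_mul, hs, one_mul]
        exact (PiLp.norm_apply_le (D k ω) i).trans hω)
      (fun k => by
        have h1 := l.comp_condExp_comm (m := 𝒢 k) (hD k)
        rw [hl]
        refine h1.symm.trans ?_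
        filter_upwards [hzero k] with ω hω
        simp [hω])
      (by positivity) hV hbV
    rwa [div_pow, Real.sq_sqrt hd.le, div_div, show (d : ℝ) * (2 * V) = 2 * d * V by ring] at h
  have hsub : {ω | ∃ n, δ ≤ ‖∑ k ∈ Finset.range n, D k ω‖} ⊆
      ⋃ i : Fin d, ({ω | ∃ n, δ / √d ≤ ∑ k ∈ Finset.range n, 1 * D k ω i} ∪
        {ω | ∃ n, δ / √d ≤ ∑ k ∈ Finset.range n, (-1) * D k ω i}) := by
    rintro ω ⟨n, hn⟩
    obtain ⟨i, hi⟩ := exists_coord_ge hδ hn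
    rw [WithLp.ofLp_sum, Finset.sum_apply] at hi
    refine Set.mem_iUnion.2 ⟨i, ?_⟩
    rcases le_abs.1 hi with h | h
    · exact Or.inl ⟨n, by simpa using h⟩
    · exact Or.inr ⟨n, by simpa using h⟩
  calc _ ≤ ∑ i : Fin d, (ENNReal.ofReal (Real.exp (-(δ ^ 2 / (2 * d * V)))) +
          ENNReal.ofReal (Real.exp (-(δ ^ 2 / (2 * d * V))))) := by
        refine (measure_mono hsub).trans ((measure_iUnion_fintype_le _ _).trans
          (Finset.sum_le_sum fun i _ => (measure_union_le _ _).trans (add_le_add ?_ ?_)))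
        · exact hcoord 1 (by simp) i
        · exact hcoord (-1) (by simp) i
    _ = _ := by
        rw [Finset.sum_const, Finset.card_univ, Fintype.card_fin, nsmul_eq_mul, ← two_mul,
          ← ENNReal.ofReal_natCast, ← ENNReal.ofReal_ofNat, ← ENNReal.ofReal_mul (by norm_num),
          ← ENNReal.ofReal_mul (by positivity)]
        congr 1
        ring

/-! ### Conditional expectations through the kernel and under conditioning. -/

/-- If `κ (X ω)` is the conditional law of `Y` given `m` and `X` is `m`-measurable, conditional
expectations of functions of `(X, Y)` are integrals against `κ`. -/
theorem condExp_eq_integral_of_transition {Ω E F G : Type*} {m mΩ : MeasurableSpace Ω}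
    [MeasurableSpace E] [MeasurableSpace F] [NormedAddCommGroup G] [NormedSpace ℝ G]
    [CompleteSpace G] {μ : Measure Ω} [IsProbabilityMeasure μ] (hm : m ≤ mΩ)
    {κ : Kernel E F} [IsMarkovKernel κ] {X : Ω → E} {Y : Ω → F}
    (hX : Measurable[m] X) (hY : Measurable Y)
    (htr : ∀ A, MeasurableSet A → μ⟦Y ⁻¹' A | m⟧ =ᵐ[μ] fun ω => (κ (X ω)).real A)
    {g : E × F → G} (hg : StronglyMeasurable g) (hint : Integrable (fun ω => g (X ω, Y ω)) μ) :
    μ[fun ω => g (X ω, Y ω) | m] =ᵐ[μ] fun ω => ∫ y, g (X ω, y) ∂(κ (X ω)) := by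
  have hX' : Measurable X := hX.mono hm le_rfl
  -- Laws on the product are determined by rectangles A × B; there the claim is the transition
  -- property integrated over X⁻¹(A) ∩ s, a set of `m`.
  have hlaw : ∀ s, MeasurableSet[m] s →
      (μ.restrict s).map (fun ω => (X ω, Y ω)) = ((μ.restrict s).map X) ⊗ₘ κ := by
    intro s hs
    refine Measure.ext_prod fun {A B} hA hB => ?_
    have hsA : MeasurableSet[m] (X ⁻¹' A ∩ s) := (hX hA).inter hs
    rw [Measure.compProd_apply_prod hA hB, Measure.map_apply (hX'.prodMk hY) (hA.prod hB),
      setLIntegral_map hA (κ.measurable_coe hB) hX',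
      Measure.restrict_restrict (hX' hA), Measure.restrict_apply ((hX'.prodMk hY) (hA.prod hB))]
    have h1 := setIntegral_condExp hm (μ := μ)
      ((integrable_const (1 : ℝ)).indicator (hY hB)) hsA
    rw [setIntegral_congr_ae (hm _ hsA) ((htr B hB).mono fun ω hω _ => hω),
      setIntegral_indicator (hY hB), setIntegral_const, smul_eq_mul, mul_one] at h1
    have h2 : ∫⁻ ω in X ⁻¹' A ∩ s, κ (X ω) B ∂μ
        = ENNReal.ofReal (∫ ω in X ⁻¹' A ∩ s, (κ (X ω)).real B ∂μ) := by
      rw [ofReal_integral_eq_lintegral_ofReal]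
      · exact lintegral_congr fun ω => (ofReal_measureReal).symm
      · refine Integrable.of_bound
          ((κ.measurable_coe hB).ennreal_toReal.comp hX').aestronglyMeasurable 1
          (ae_of_all _ fun ω => ?_)
        rw [Real.norm_eq_abs, abs_of_nonneg measureReal_nonneg]
        exact measureReal_le_one
      · exact ae_of_all _ fun ω => measureReal_nonneg
    rw [h2, h1, ofReal_measureReal]
    congr 1
    ext ω
    simp only [Set.mem_inter_iff, Set.mem_preimage, Set.mem_prod]
    tauto
  have hsm : StronglyMeasurable[m] fun ω => ∫ y, g (X ω, y) ∂(κ (X ω)) :=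
    (StronglyMeasurable.integral_kernel_prod_right' (κ := κ) hg).comp_measurable hX
  have hint' : ∀ s, MeasurableSet[m] s → Integrable g (((μ.restrict s).map X) ⊗ₘ κ) := by
    intro s hs
    rw [← hlaw s hs, integrable_map_measure hg.aestronglyMeasurable
      (hX'.prodMk hY).aemeasurable]
    exact hint.restrict
  refine (ae_eq_condExp_of_forall_setIntegral_eq hm hint (fun s hs _ => ?_) (fun s hs _ => ?_)
    hsm.aestronglyMeasurable).symm
  · have h := Integrable.integral_compProd (hint' s hs)
    simp only [Kernel.const_apply, Kernel.prodMkLeft_apply] at h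
    rw [integrable_map_measure h.aestronglyMeasurable hX'.aemeasurable] at h
    exact h
  · have h1 := Measure.integral_compProd (hint' s hs)
    rw [← hlaw s hs, integral_map (hX'.prodMk hY).aemeasurable hg.aestronglyMeasurable,
      integral_map hX'.aemeasurable
        (StronglyMeasurable.integral_kernel_prod_right' (κ := κ) hg).aestronglyMeasurable] at h1
    exact h1.symm

/-- Conditioning on an event of `m` preserves vanishing conditional expectations given `m`. -/
lemma condExp_cond_eq_zero {Ω G : Type*} {m mΩ : MeasurableSpace Ω} [NormedAddCommGroup G]
    [NormedSpace ℝ G] [CompleteSpace G] {μ : Measure Ω} [IsProbabilityMeasure μ] (hm : m ≤ mΩ)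
    {s : Set Ω} (hs : MeasurableSet[m] s) (hμs : μ s ≠ 0) {D : Ω → G} (hD : Integrable D μ)
    (hzero : μ[D | m] =ᵐ[μ] 0) : (cond μ s)[D | m] =ᵐ[cond μ s] 0 := by
  have := cond_isProbabilityMeasure hμs
  have hDc : Integrable D (cond μ s) := hD.restrict.smul_measure (ENNReal.inv_ne_top.2 hμs)
  refine (ae_eq_condExp_of_forall_setIntegral_eq hm hDc (fun t ht _ => ?_) (fun t ht _ => ?_)
    aestronglyMeasurable_zero).symm
  · exact integrableOn_zero
  · have h : ∫ ω in t ∩ s, D ω ∂μ = 0 := by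
      rw [← setIntegral_condExp hm hD (ht.inter hs),
        setIntegral_congr_ae (hm _ (ht.inter hs)) (hzero.mono fun ω hω _ => hω)]
      simp
    rw [ProbabilityTheory.cond, Measure.restrict_smul, Measure.restrict_restrict (hm _ ht),
      integral_smul_measure, integral_smul_measure, h]
    simp

/-! ### Deterministic estimates. -/

section Deterministic

variable {E : Type*} [NormedAddCommGroup E] [NormedSpace ℝ E]

/-- Summation by parts for weighted sums of `p j - q j` with `q j` close to `p (j + 1)`. -/
lemma norm_sum_smul_sub_le {b : ℕ → ℝ} {p q : ℕ → E} {V H : ℝ} (hb : ∀ k, 0 ≤ b k)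
    (hanti : Antitone b) (n : ℕ) (hp : ∀ j ≤ n, ‖p j‖ ≤ V) (hq : ∀ j ≤ n, ‖q j‖ ≤ V)
    (hpq : ∀ j < n, ‖p (j + 1) - q j‖ ≤ H * b j) :
    ‖∑ j ∈ Finset.range (n + 1), b j • (p j - q j)‖
      ≤ 2 * b 0 * V + H * ∑ j ∈ Finset.range n, b j ^ 2 := by
  -- Adding back the last `q` leaves increments made of b(k+1) - b(k), which telescope in norm by
  -- monotonicity, and of p(k+1) - q(k).
  have key : ∀ k ≤ n, ‖∑ j ∈ Finset.range (k + 1), b j • (p j - q j) + b k • q k‖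
      ≤ b 0 * V + (b 0 - b k) * V + H * ∑ j ∈ Finset.range k, b j ^ 2 := by
    intro k
    induction k with
    | zero =>
      intro _
      simp only [zero_add, Finset.sum_range_one, Finset.range_zero, Finset.sum_empty, mul_zero,
        sub_self, zero_mul, add_zero]
      rw [← smul_add, sub_add_cancel, norm_smul, Real.norm_of_nonneg (hb 0)]
      exact mul_le_mul_of_nonneg_left (hp 0 (Nat.zero_le _)) (hb 0)
    | succ k ih =>
      intro hk
      have e : ∑ j ∈ Finset.range (k + 1 + 1), b j • (p j - q j) + b (k + 1) • q (k + 1)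
          = (∑ j ∈ Finset.range (k + 1), b j • (p j - q j) + b k • q k)
            + ((b (k + 1) - b k) • p (k + 1) + b k • (p (k + 1) - q k)) := by
        rw [Finset.sum_range_succ _ (k + 1)]
        module
      have h1 : ‖(b (k + 1) - b k) • p (k + 1)‖ ≤ (b k - b (k + 1)) * V := by
        rw [norm_smul, Real.norm_eq_abs, abs_sub_comm,
          abs_of_nonneg (sub_nonneg.2 (hanti (Nat.le_succ k)))]
        exact mul_le_mul_of_nonneg_left (hp _ hk) (sub_nonneg.2 (hanti (Nat.le_succ k)))
      have h2 : ‖b k • (p (k + 1) - q k)‖ ≤ b k * (H * b k) := by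
        rw [norm_smul, Real.norm_of_nonneg (hb k)]
        exact mul_le_mul_of_nonneg_left (hpq k hk) (hb k)
      rw [e, Finset.sum_range_succ (fun j => b j ^ 2)]
      have h3 := ih (Nat.le_of_succ_le hk)
      have h4 := norm_add_le (∑ j ∈ Finset.range (k + 1), b j • (p j - q j) + b k • q k)
        ((b (k + 1) - b k) • p (k + 1) + b k • (p (k + 1) - q k))
      have h5 := norm_add_le ((b (k + 1) - b k) • p (k + 1)) (b k • (p (k + 1) - q k))
      linarith
  have h1 := key n le_rfl
  have h2 : ‖b n • q n‖ ≤ b n * V := by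
    rw [norm_smul, Real.norm_of_nonneg (hb n)]
    exact mul_le_mul_of_nonneg_left (hq n le_rfl) (hb n)
  have h3 := norm_sub_le (∑ j ∈ Finset.range (n + 1), b j • (p j - q j) + b n • q n) (b n • q n)
  rw [add_sub_cancel_right] at h3
  linarith

/-- A damped fixed point iteration of an `α`-contraction, started within `3ε/2` of the fixed point
and with accumulated noise at most `(1 - α) ε / 4`, stays within `2ε` of it. -/
lemma norm_iterate_sub_lt {b : ℕ → ℝ} {x ξ : ℕ → E} {u : E → E} {xs : E} {α ε : ℝ}
    (hα0 : 0 < α) (hα1 : α < 1) (hε : 0 < ε) (hb0 : ∀ k, 0 ≤ b k) (hb1 : ∀ k, b k ≤ 1)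
    (hu : ∀ x y, ‖u x - u y‖ ≤ α * ‖x - y‖) (hfix : u xs = xs)
    (hrec : ∀ k, x (k + 1) = x k + b k • (u (x k) - x k + ξ k))
    (hinit : ‖x 0 - xs‖ ≤ 3 * ε / 2)
    (hnoise : ∀ k, (∀ j < k, ‖x j - xs‖ < 2 * ε) →
      ‖∑ j ∈ Finset.range k, b j • ξ j‖ ≤ (1 - α) * ε / 4) (k : ℕ) :
    ‖x k - xs‖ < 2 * ε := by
  set ζ : ℕ → E := fun k => ∑ j ∈ Finset.range k, b j • ξ j with hζ
  -- The invariant concerns the iterate with its accumulated noise removed. The first clause is what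
  -- `hnoise` demands.
  have key : ∀ k, (∀ j < k, ‖x j - xs‖ < 2 * ε) ∧ ‖x k - xs - ζ k‖ ≤ 3 * ε / 2 := by
    intro k
    induction k with
    | zero => exact ⟨by simp, by simpa [hζ] using hinit⟩
    | succ k ih =>
      obtain ⟨ih1, ih2⟩ := ih
      have hζk : ‖ζ k‖ ≤ (1 - α) * ε / 4 := hnoise k ih1
      have htri : ‖x k - xs‖ ≤ ‖x k - xs - ζ k‖ + ‖ζ k‖ := by
        simpa using norm_add_le (x k - xs - ζ k) (ζ k)
      have hxk : ‖x k - xs‖ < 2 * ε := by nlinarith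
      refine ⟨fun j hj => ?_, ?_⟩
      · rcases Nat.lt_succ_iff_lt_or_eq.1 hj with h | rfl
        · exact ih1 j h
        · exact hxk
      have e : x (k + 1) - xs - ζ (k + 1)
          = (1 - b k) • (x k - xs - ζ k) + b k • ((u (x k) - u xs) - ζ k) := by
        simp only [hζ, Finset.sum_range_succ, hrec k, hfix]
        module
      have h1 : ‖(1 - b k) • (x k - xs - ζ k)‖ ≤ (1 - b k) * (3 * ε / 2) := by
        rw [norm_smul, Real.norm_of_nonneg (sub_nonneg.2 (hb1 k))]
        exact mul_le_mul_of_nonneg_left ih2 (sub_nonneg.2 (hb1 k))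
      -- With z = (1-α)ε/4 this is α(3ε/2 + z) + z ≤ 3ε/2, that is (1+α)/4 ≤ 3/2.
      have h3 : ‖(u (x k) - u xs) - ζ k‖ ≤ 3 * ε / 2 := by
        have := norm_sub_le (u (x k) - u xs) (ζ k)
        have := hu (x k) xs
        have h4 : α * ‖x k - xs‖ ≤ α * (3 * ε / 2 + (1 - α) * ε / 4) :=
          mul_le_mul_of_nonneg_left (htri.trans (add_le_add ih2 hζk)) hα0.le
        nlinarith [mul_pos (sub_pos.2 hα1) hε, mul_pos (sub_pos.2 hα1) (mul_pos (sub_pos.2 hα1) hε)]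
      have h2 : ‖b k • ((u (x k) - u xs) - ζ k)‖ ≤ b k * (3 * ε / 2) := by
        rw [norm_smul, Real.norm_of_nonneg (hb0 k)]
        exact mul_le_mul_of_nonneg_left h3 (hb0 k)
      rw [e]
      have := norm_add_le ((1 - b k) • (x k - xs - ζ k)) (b k • ((u (x k) - u xs) - ζ k))
      linarith
  exact (key (k + 1)).1 k (Nat.lt_succ_self k)

end Deterministic

/-! ### Step-size tails, noise decomposition and bounds on the model. -/

lemma tailSq_pos {a : ℕ → ℝ} (ha : IsStepSize a) (n : ℕ) : 0 < tailSq a n := by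
  have hs : Summable fun m => a (n + m) ^ 2 := by
    simpa only [add_comm] using (summable_nat_add_iff n).2 ha.sum_sq_converges
  exact hs.tsum_pos (fun _ => sq_nonneg _) 0 (pow_pos (ha.pos _) 2)

lemma sum_sq_le_tailSq {a : ℕ → ℝ} (ha : IsStepSize a) (n k : ℕ) :
    ∑ j ∈ Finset.range k, a (n + j) ^ 2 ≤ tailSq a n := by
  have hs : Summable fun m => a (n + m) ^ 2 := by
    simpa only [add_comm] using (summable_nat_add_iff n).2 ha.sum_sq_converges
  exact hs.sum_le_tsum _ fun _ _ => sq_nonneg _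

/-- The filtration `ℱ` started at time `n`. -/
def shiftFiltration {Ω : Type*} {mΩ : MeasurableSpace Ω} (ℱ : Filtration ℕ mΩ) (n : ℕ) :
    Filtration ℕ mΩ where
  seq k := ℱ (n + k)
  mono' _ _ h := ℱ.mono (Nat.add_le_add_left h n)
  le' _ := ℱ.le _

/-- The martingale part of the noise at time `n`, with the conditional mean of `v (θ n) (Y (n + 1))`
expressed through the Poisson equation. -/
noncomputable def martingaleNoise {d : ℕ} {Ω : Type*} (f : Vec d → Vec d → Vec d)
    (Γ : Vec d → Measure (Vec d)) (v : Vec d → Vec d → Vec d) (θ Y M : ℕ → Ω → Vec d) (n : ℕ)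
    (ω : Ω) : Vec d :=
  M (n + 1) ω + v (θ n ω) (Y (n + 1) ω)
    + (f (θ n ω) (Y n ω) - avgMap f Γ (θ n ω) - v (θ n ω) (Y n ω))

namespace IsNoiseModel

variable {d : ℕ} {f : Vec d → Vec d → Vec d} {κ : Kernel (Vec d × Vec d) (Vec d)}
  {Γ : Vec d → Measure (Vec d)} {v : Vec d → Vec d → Vec d} {K : ℝ} {CR : ℝ → ℝ}

lemma continuous_v (h : IsNoiseModel f κ Γ v K CR) (x : Vec d) : Continuous fun θ => v θ x := by
  refine continuous_iff_continuousAt.2 fun θ₀ => ?_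
  have hR : 0 < ‖θ₀‖ + 1 := by positivity
  refine tendsto_iff_norm_sub_tendsto_zero.2 ?_
  refine squeeze_zero' (Filter.Eventually.of_forall fun _ => norm_nonneg _)
    (g := fun θ => CR (‖θ₀‖ + 1) * ‖θ - θ₀‖ * (1 + ‖x‖)) ?_ ?_
  · filter_upwards [Metric.ball_mem_nhds θ₀ one_pos] with θ hθ
    refine h.lipschitz_v _ hR θ θ₀ ?_ (by linarith) x
    rw [mem_ball_iff_norm] at hθ
    have := norm_add_le (θ - θ₀) θ₀
    rw [sub_add_cancel] at this
    linarith
  · have hc : Continuous fun θ => CR (‖θ₀‖ + 1) * ‖θ - θ₀‖ * (1 + ‖x‖) := by fun_prop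
    simpa using hc.tendsto θ₀

/-- A Carathéodory function: continuous in θ, measurable in x. -/
lemma measurable_uncurry_v (h : IsNoiseModel f κ Γ v K CR) :
    Measurable fun p : Vec d × Vec d => v p.1 p.2 :=
  (stronglyMeasurable_uncurry_of_continuous_of_stronglyMeasurable h.continuous_v
    fun θ => (h.measurable_v θ).stronglyMeasurable).measurable

variable {R Cbar : ℝ} {θ y : Vec d}

/-- Absolute values of the constants appear in these bounds because the final constants are chosen
before any sign information is available. -/
lemma norm_f_le (h : IsNoiseModel f κ Γ v K CR) (hθ : ‖θ‖ ≤ R) (y : Vec d) :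
    ‖f θ y‖ ≤ |K| * (1 + R) :=
  (h.growth_f θ y).trans (mul_le_mul (le_abs_self K) (by linarith)
    (by positivity) (abs_nonneg K))

lemma norm_avgMap_le (h : IsNoiseModel f κ Γ v K CR) (hθ : ‖θ‖ ≤ R) :
    ‖avgMap f Γ θ‖ ≤ |K| * (1 + R) := by
  have := h.prob θ
  simpa [avgMap] using norm_integral_le_of_norm_le_const (μ := Γ θ) (ae_of_all _ (h.norm_f_le hθ))

lemma norm_v_le (h : IsNoiseModel f κ Γ v K CR) (hR : 0 < R) (hθ : ‖θ‖ ≤ R) (hy : ‖y‖ ≤ Cbar) :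
    ‖v θ y‖ ≤ |CR R| * (1 + Cbar) :=
  (h.growth_v R hR θ hθ y).trans (mul_le_mul (le_abs_self _) (by linarith)
    (by positivity) (abs_nonneg _))

end IsNoiseModel

/-! ### The martingale part of the noise. -/

section Iteration

variable {d : ℕ} {Ω : Type*} [mΩ : MeasurableSpace Ω] {μ : Measure Ω} [IsProbabilityMeasure μ]
  {ℱ : Filtration ℕ mΩ} {a : ℕ → ℝ} {f : Vec d → Vec d → Vec d}
  {κ : Kernel (Vec d × Vec d) (Vec d)} {Γ : Vec d → Measure (Vec d)} {v : Vec d → Vec d → Vec d}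
  {θ Y M : ℕ → Ω → Vec d} {K K' Cbar R : ℝ} {CR : ℝ → ℝ} {n₁ : ℕ}

omit [IsProbabilityMeasure μ] in
lemma measurable_driftPart (hmod : IsNoiseModel f κ Γ v K CR)
    (hit : IsFixedPointIteration μ ℱ a f κ θ Y M K' Cbar n₁) (hu : Continuous (avgMap f Γ)) (n : ℕ) :
    Measurable[ℱ n] fun ω =>
      f (θ n ω) (Y n ω) - avgMap f Γ (θ n ω) - v (θ n ω) (Y n ω) := by
  have hp : Measurable[ℱ n] fun ω => (θ n ω, Y n ω) :=
    (hit.measurable_θ n).prodMk (hit.measurable_Y n)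
  exact ((hmod.measurable_f.comp hp).sub (hu.measurable.comp (hit.measurable_θ n))).sub
    (hmod.measurable_uncurry_v.comp hp)

omit [IsProbabilityMeasure μ] in
lemma measurable_martingaleNoise (hmod : IsNoiseModel f κ Γ v K CR)
    (hit : IsFixedPointIteration μ ℱ a f κ θ Y M K' Cbar n₁) (hu : Continuous (avgMap f Γ)) (n : ℕ) :
    Measurable[ℱ (n + 1)] (martingaleNoise f Γ v θ Y M n) := by
  have hle : ℱ n ≤ ℱ (n + 1) := ℱ.mono (Nat.le_succ n)
  exact ((hit.measurable_M n).add (hmod.measurable_uncurry_v.comp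
    (((hit.measurable_θ n).mono hle le_rfl).prodMk (hit.measurable_Y (n + 1))))).add
    ((measurable_driftPart hmod hit hu n).mono hle le_rfl)

omit [IsProbabilityMeasure μ] in
lemma norm_martingaleNoise_le (hmod : IsNoiseModel f κ Γ v K CR)
    (hit : IsFixedPointIteration μ ℱ a f κ θ Y M K' Cbar n₁) (hR : 0 < R) {n : ℕ} (hn : n₁ ≤ n) :
    ∀ᵐ ω ∂μ, ‖θ n ω‖ ≤ R → ‖martingaleNoise f Γ v θ Y M n ω‖ ≤
      |K'| * (1 + R) + 2 * (|CR R| * (1 + Cbar)) + 2 * (|K| * (1 + R)) := by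
  filter_upwards [hit.bounded_Y n hn, hit.bounded_Y (n + 1) (hn.trans (Nat.le_succ n)),
    hit.bounded_M n] with ω h1 h2 h3 hθ
  have e1 := hmod.norm_v_le hR hθ h1
  have e2 := hmod.norm_v_le hR hθ h2
  have e3 := hmod.norm_f_le hθ (Y n ω)
  have e4 := hmod.norm_avgMap_le hθ
  have e5 : ‖M (n + 1) ω‖ ≤ |K'| * (1 + R) :=
    h3.trans (mul_le_mul (le_abs_self _) (by linarith) (by positivity) (abs_nonneg _))
  have t1 := norm_add_le (M (n + 1) ω + v (θ n ω) (Y (n + 1) ω))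
    (f (θ n ω) (Y n ω) - avgMap f Γ (θ n ω) - v (θ n ω) (Y n ω))
  have t2 := norm_add_le (M (n + 1) ω) (v (θ n ω) (Y (n + 1) ω))
  have t3 := norm_sub_le (f (θ n ω) (Y n ω) - avgMap f Γ (θ n ω)) (v (θ n ω) (Y n ω))
  have t4 := norm_sub_le (f (θ n ω) (Y n ω)) (avgMap f Γ (θ n ω))
  unfold martingaleNoise
  linarith

/-- Given ℱ_n, the mean of v_{θ_n}(Y_{n+1}) is its integral against Π_{θ_n}(Y_n; ·), which the
Poisson equation cancels against the drift part. Restricting to `S` supplies boundedness. -/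
lemma condExp_indicator_martingaleNoise (hmod : IsNoiseModel f κ Γ v K CR)
    (hit : IsFixedPointIteration μ ℱ a f κ θ Y M K' Cbar n₁) (hu : Continuous (avgMap f Γ))
    (hR : 0 < R) {n : ℕ} (hn : n₁ ≤ n) {S : Set Ω} (hS : MeasurableSet[ℱ n] S)
    (hSR : ∀ ω ∈ S, ‖θ n ω‖ ≤ R) :
    μ[S.indicator (martingaleNoise f Γ v θ Y M n) | ℱ n] =ᵐ[μ] 0 := by
  have := hmod.markov
  -- Cutting off at ‖θ‖ ≤ R makes `B` bounded on all of Ω, hence integrable, without changing it on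
  -- `S`.
  let g : (Vec d × Vec d) × Vec d → Vec d :=
    {p : (Vec d × Vec d) × Vec d | ‖p.1.1‖ ≤ R}.indicator fun p => v p.1.1 p.2
  let A : Ω → Vec d := M (n + 1)
  let B : Ω → Vec d := fun ω => g ((θ n ω, Y n ω), Y (n + 1) ω)
  let C : Ω → Vec d := S.indicator fun ω =>
    f (θ n ω) (Y n ω) - avgMap f Γ (θ n ω) - v (θ n ω) (Y n ω)
  have hg : StronglyMeasurable g := by
    refine Measurable.stronglyMeasurable (Measurable.indicator ?_ ?_)
    · exact hmod.measurable_uncurry_v.comp (measurable_fst.fst.prodMk measurable_snd)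
    · exact measurableSet_le measurable_fst.fst.norm measurable_const
  have hXm : Measurable[ℱ n] fun ω => (θ n ω, Y n ω) :=
    (hit.measurable_θ n).prodMk (hit.measurable_Y n)
  have hYm : Measurable (Y (n + 1)) := (hit.measurable_Y (n + 1)).mono (ℱ.le _) le_rfl
  have hV : 0 ≤ |CR R| * (1 + Cbar) := by
    obtain ⟨ω, hω⟩ := (hit.bounded_Y n hn).exists
    have := (norm_nonneg _).trans hω
    positivity
  have hA : Integrable A μ := hit.integrable_M n
  have hB : Integrable B μ := by
    refine Integrable.of_bound (hg.comp_measurable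
      ((hXm.mono (ℱ.le n) le_rfl).prodMk hYm)).aestronglyMeasurable (|CR R| * (1 + Cbar)) ?_
    filter_upwards [hit.bounded_Y (n + 1) (hn.trans (Nat.le_succ n))] with ω hω
    by_cases hθ : ‖θ n ω‖ ≤ R
    · simpa [B, g, hθ] using hmod.norm_v_le hR hθ hω
    · simpa [B, g, hθ] using hV
  have hCm : StronglyMeasurable[ℱ n] C :=
    ((measurable_driftPart hmod hit hu n).indicator hS).stronglyMeasurable
  have hC : Integrable C μ := by
    refine Integrable.of_bound (hCm.mono (ℱ.le n)).aestronglyMeasurable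
      (2 * (|K| * (1 + R)) + |CR R| * (1 + Cbar)) ?_
    filter_upwards [hit.bounded_Y n hn] with ω hω
    by_cases hωS : ω ∈ S
    · have hθ := hSR ω hωS
      simp only [C, Set.indicator_of_mem hωS]
      have e1 := hmod.norm_v_le hR hθ hω
      have e3 := hmod.norm_f_le hθ (Y n ω)
      have e4 := hmod.norm_avgMap_le hθ
      have t3 := norm_sub_le (f (θ n ω) (Y n ω) - avgMap f Γ (θ n ω)) (v (θ n ω) (Y n ω))
      have t4 := norm_sub_le (f (θ n ω) (Y n ω)) (avgMap f Γ (θ n ω))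
      linarith
    · simp only [C, Set.indicator_of_notMem hωS, norm_zero]
      positivity
  have hsplit : S.indicator (martingaleNoise f Γ v θ Y M n) = S.indicator (A + B + C) := by
    ext1 ω
    by_cases hωS : ω ∈ S
    · have hθ := hSR ω hωS
      simp [hωS, A, B, C, g, hθ, martingaleNoise]
    · simp [hωS]
  rw [hsplit]
  have hBc := condExp_eq_integral_of_transition (ℱ.le n) hXm hYm (hit.transition n) hg hB
  filter_upwards [condExp_indicator ((hA.add hB).add hC) hS, condExp_add (hA.add hB) hC (ℱ n),
    condExp_add hA hB (ℱ n), hit.martingale_M n, hBc] with ω h1 h2 h3 h4 h5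
  rw [h1]
  by_cases hωS : ω ∈ S
  · have hθ := hSR ω hωS
    have hp := hmod.poisson (θ n ω) (Y n ω)
    rw [Set.indicator_of_mem hωS, h2, Pi.add_apply, h3, Pi.add_apply, h4, h5,
      condExp_of_stronglyMeasurable (ℱ.le n) hCm hC]
    simp only [g, C, hωS, hθ, Set.indicator_of_mem, Set.mem_ofPred_eq, Pi.zero_apply, zero_add,
      ← hp]
    simp
  · rw [Set.indicator_of_notMem hωS, Pi.zero_apply]

end Iteration

/-! ### Pathwise stability and the probability of a deviation. -/

section Iteration

variable {d : ℕ} {Ω : Type*} [mΩ : MeasurableSpace Ω] {μ : Measure Ω}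
  {ℱ : Filtration ℕ mΩ} {a : ℕ → ℝ} {f : Vec d → Vec d → Vec d}
  {κ : Kernel (Vec d × Vec d) (Vec d)} {Γ : Vec d → Measure (Vec d)} {v : Vec d → Vec d → Vec d}
  {θ Y M : ℕ → Ω → Vec d} {K K' Cbar R : ℝ} {CR : ℝ → ℝ} {n₁ : ℕ}

/-- The correction terms `v (θ j) (Y j) - v (θ j) (Y (j + 1))` accumulate to order
`a n₀ + tailSq a n₀` while the iterates stay bounded. -/
lemma norm_sum_poissonCorrection_le (hmod : IsNoiseModel f κ Γ v K CR)
    (hit : IsFixedPointIteration μ ℱ a f κ θ Y M K' Cbar n₁) (ha : IsStepSize a) (hCbar : 0 < Cbar)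
    (hR : 0 < R) {n₀ : ℕ} {ω : Ω} (hY : ∀ j, ‖Y (n₀ + j) ω‖ ≤ Cbar)
    (hM : ∀ j, ‖M (n₀ + j + 1) ω‖ ≤ K' * (1 + ‖θ (n₀ + j) ω‖)) {k : ℕ}
    (hθ : ∀ j < k, ‖θ (n₀ + j) ω‖ ≤ R) :
    ‖∑ j ∈ Finset.range k, a (n₀ + j) • (v (θ (n₀ + j) ω) (Y (n₀ + j) ω)
        - v (θ (n₀ + j) ω) (Y (n₀ + j + 1) ω))‖
      ≤ 2 * a n₀ * (|CR R| * (1 + Cbar)) + |CR R| * (1 + Cbar)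
        * (|K| * (1 + R) + R + |K'| * (1 + R)) * tailSq a n₀ := by
  have hG : 0 ≤ |K| * (1 + R) + R + |K'| * (1 + R) := by positivity
  have ha0 := ha.pos n₀
  rcases k with _ | n
  · have := tailSq_pos ha n₀
    simp only [Finset.range_zero, Finset.sum_empty, norm_zero]
    positivity
  -- Here p(j+1) and q(j) share the argument Y_{n₀+j+1} and differ only in θ, by one step of size
  -- O(a(n₀+j)).
  have h := norm_sum_smul_sub_le (b := fun j => a (n₀ + j))
    (p := fun j => v (θ (n₀ + j) ω) (Y (n₀ + j) ω))
    (q := fun j => v (θ (n₀ + j) ω) (Y (n₀ + j + 1) ω)) (V := |CR R| * (1 + Cbar))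
    (H := |CR R| * (1 + Cbar) * (|K| * (1 + R) + R + |K'| * (1 + R)))
    (fun j => (ha.pos _).le) (fun i j hij => ha.antitone (Nat.add_le_add_left hij n₀)) n
    (fun j hj => hmod.norm_v_le hR (hθ j (Nat.lt_succ_of_le hj)) (hY j))
    (fun j hj => hmod.norm_v_le hR (hθ j (Nat.lt_succ_of_le hj)) (hY (j + 1)))
    (fun j hj => by
      have hj0 := hθ j (by omega)
      have hj1 := hθ (j + 1) (by omega)
      have hstep : ‖θ (n₀ + (j + 1)) ω - θ (n₀ + j) ω‖
          ≤ a (n₀ + j) * (|K| * (1 + R) + R + |K'| * (1 + R)) := by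
        rw [← add_assoc, hit.recursion, add_sub_cancel_left, norm_smul,
          Real.norm_of_nonneg (ha.pos _).le]
        refine mul_le_mul_of_nonneg_left ?_ (ha.pos _).le
        have e1 := hmod.norm_f_le hj0 (Y (n₀ + j) ω)
        have e2 : ‖M (n₀ + j + 1) ω‖ ≤ |K'| * (1 + R) := (hM j).trans
          (mul_le_mul (le_abs_self _) (by linarith) (by positivity) (abs_nonneg _))
        exact (norm_add_le _ _).trans
          (add_le_add ((norm_sub_le _ _).trans (add_le_add e1 hj0)) e2)
      have hl := hmod.lipschitz_v R hR _ _ hj1 hj0 (Y (n₀ + (j + 1)) ω)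
      calc _ ≤ CR R * ‖θ (n₀ + (j + 1)) ω - θ (n₀ + j) ω‖ * (1 + ‖Y (n₀ + (j + 1)) ω‖) := hl
        _ ≤ |CR R| * (a (n₀ + j) * (|K| * (1 + R) + R + |K'| * (1 + R))) * (1 + Cbar) := by
          have := hY (j + 1)
          have := ha.pos (n₀ + j)
          gcongr
          exact le_abs_self _
        _ = _ := by ring)
  refine h.trans ?_
  have hs := sum_sq_le_tailSq ha n₀ n
  simp only [add_zero]
  gcongr

/-- Pathwise stability: small accumulated martingale noise keeps the iterates near `θstar`. -/
lemma norm_iterate_sub_lt_of_martingaleNoise (hmod : IsNoiseModel f κ Γ v K CR)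
    (hit : IsFixedPointIteration μ ℱ a f κ θ Y M K' Cbar n₁) (ha : IsStepSize a) (hCbar : 0 < Cbar)
    {α ε : ℝ} {θstar : Vec d} (hα0 : 0 < α) (hα1 : α < 1) (hε : 0 < ε)
    (hu : ∀ x y, ‖avgMap f Γ x - avgMap f Γ y‖ ≤ α * ‖x - y‖) (hfix : avgMap f Γ θstar = θstar)
    (hR : ‖θstar‖ + 2 * ε ≤ R) {n₀ : ℕ} {ω : Ω} (ha1 : a n₀ ≤ 1)
    (hsmall : 2 * a n₀ * (|CR R| * (1 + Cbar)) + |CR R| * (1 + Cbar)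
        * (|K| * (1 + R) + R + |K'| * (1 + R)) * tailSq a n₀ ≤ (1 - α) * ε / 8)
    (hY : ∀ j, ‖Y (n₀ + j) ω‖ ≤ Cbar)
    (hM : ∀ j, ‖M (n₀ + j + 1) ω‖ ≤ K' * (1 + ‖θ (n₀ + j) ω‖))
    (hinit : ‖θ n₀ ω - θstar‖ ≤ 3 * ε / 2)
    (hmart : ∀ k, (∀ j < k, ‖θ (n₀ + j) ω - θstar‖ < 2 * ε) →
      ‖∑ j ∈ Finset.range k, a (n₀ + j) • martingaleNoise f Γ v θ Y M (n₀ + j) ω‖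
        ≤ (1 - α) * ε / 8) (k : ℕ) :
    ‖θ (n₀ + k) ω - θstar‖ < 2 * ε := by
  have hRpos : 0 < R := by
    have := norm_nonneg θstar
    linarith
  refine norm_iterate_sub_lt (b := fun k => a (n₀ + k)) (x := fun k => θ (n₀ + k) ω)
    (ξ := fun k => f (θ (n₀ + k) ω) (Y (n₀ + k) ω) - avgMap f Γ (θ (n₀ + k) ω) + M (n₀ + k + 1) ω)
    hα0 hα1 hε (fun k => (ha.pos _).le) (fun k => (ha.antitone (Nat.le_add_right _ _)).trans ha1)
    hu hfix (fun k => ?_) hinit (fun k hk => ?_) k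
  · rw [← add_assoc, hit.recursion]
    congr 2
    abel
  · have h1 := norm_sum_poissonCorrection_le hmod hit ha hCbar hRpos hY hM (k := k) fun j hj => by
      have h := norm_add_le (θ (n₀ + j) ω - θstar) θstar
      rw [sub_add_cancel] at h
      have := hk j hj
      linarith
    have h2 := hmart k hk
    have e : ∑ j ∈ Finset.range k, a (n₀ + j) •
          (f (θ (n₀ + j) ω) (Y (n₀ + j) ω) - avgMap f Γ (θ (n₀ + j) ω) + M (n₀ + j + 1) ω)
        = ∑ j ∈ Finset.range k, a (n₀ + j) • martingaleNoise f Γ v θ Y M (n₀ + j) ω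
          + ∑ j ∈ Finset.range k, a (n₀ + j) • (v (θ (n₀ + j) ω) (Y (n₀ + j) ω)
            - v (θ (n₀ + j) ω) (Y (n₀ + j + 1) ω)) := by
      rw [← Finset.sum_add_distrib]
      refine Finset.sum_congr rfl fun j _ => ?_
      rw [← smul_add, martingaleNoise]
      congr 1
      abel
    rw [e]
    have h3 := norm_add_le
      (∑ j ∈ Finset.range k, a (n₀ + j) • martingaleNoise f Γ v θ Y M (n₀ + j) ω)
      (∑ j ∈ Finset.range k, a (n₀ + j) • (v (θ (n₀ + j) ω) (Y (n₀ + j) ω)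
        - v (θ (n₀ + j) ω) (Y (n₀ + j + 1) ω)))
    linarith

/-- The event that the iterates from time `n₀` to `n₀ + k` stay within `r` of `θstar`. -/
def staySet (θ : ℕ → Ω → Vec d) (θstar : Vec d) (r : ℝ) (n₀ k : ℕ) : Set Ω :=
  {ω | ∀ j ≤ k, ‖θ (n₀ + j) ω - θstar‖ < r}

lemma measurableSet_staySet (hit : IsFixedPointIteration μ ℱ a f κ θ Y M K' Cbar n₁)
    (θstar : Vec d) (r : ℝ) (n₀ k : ℕ) : MeasurableSet[ℱ (n₀ + k)] (staySet θ θstar r n₀ k) := by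
  have e : staySet θ θstar r n₀ k = ⋂ j ∈ Finset.range (k + 1), θ (n₀ + j) ⁻¹' Metric.ball θstar r := by
    ext ω
    simp [staySet, dist_eq_norm]
  rw [e]
  refine Finset.measurableSet_biInter _ fun j hj => ?_
  exact ((hit.measurable_θ (n₀ + j)).mono
    (ℱ.mono (Nat.add_le_add_left (Nat.lt_succ_iff.1 (Finset.mem_range.1 hj)) n₀)) le_rfl)
    measurableSet_ball

/-- Deviation bound for the martingale part of the noise, stopped when the iterates leave the ball
of radius `2ε`, conditionally on an event of `ℱ n₀`. -/
lemma cond_measure_martingaleNoise_le [IsProbabilityMeasure μ] (hmod : IsNoiseModel f κ Γ v K CR)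
    (hit : IsFixedPointIteration μ ℱ a f κ θ Y M K' Cbar n₁) (ha : IsStepSize a)
    (hu : Continuous (avgMap f Γ)) {r δ L : ℝ} {θstar : Vec d} (hδ : 0 < δ)
    (hR0 : 0 < R) (hR : ‖θstar‖ + r ≤ R) (hL0 : 0 < L)
    (hL : |K'| * (1 + R) + 2 * (|CR R| * (1 + Cbar)) + 2 * (|K| * (1 + R)) ≤ L)
    {n₀ : ℕ} (hn : n₁ ≤ n₀) {G : Set Ω} (hG : MeasurableSet[ℱ n₀] G) (hμG : μ G ≠ 0) :
    cond μ G {ω | ∃ n, δ ≤ ‖∑ k ∈ Finset.range n, (staySet θ θstar r n₀ k).indicator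
        (fun ω => a (n₀ + k) • martingaleNoise f Γ v θ Y M (n₀ + k) ω) ω‖}
      ≤ ENNReal.ofReal (2 * d * Real.exp (-(δ ^ 2 / (2 * d * (L ^ 2 * tailSq a n₀))))) := by
  have := cond_isProbabilityMeasure hμG
  have hac : cond μ G ≪ μ := cond_absolutelyContinuous
  have hS := fun k => measurableSet_staySet hit θstar r n₀ k
  have hSR : ∀ k, ∀ ω ∈ staySet θ θstar r n₀ k, ‖θ (n₀ + k) ω‖ ≤ R := fun k ω hω => by
    have h := norm_add_le (θ (n₀ + k) ω - θstar) θstar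
    rw [sub_add_cancel] at h
    have := hω k le_rfl
    linarith
  have hmeas : ∀ k, Measurable[ℱ (n₀ + (k + 1))] ((staySet θ θstar r n₀ k).indicator
      (fun ω => a (n₀ + k) • martingaleNoise f Γ v θ Y M (n₀ + k) ω)) := fun k =>
    Measurable.indicator ((measurable_martingaleNoise hmod hit hu (n₀ + k)).const_smul (a (n₀ + k)))
      (ℱ.mono (Nat.le_succ _) _ (hS k))
  have hbd : ∀ k, ∀ᵐ ω ∂μ, ‖(staySet θ θstar r n₀ k).indicator
      (fun ω => a (n₀ + k) • martingaleNoise f Γ v θ Y M (n₀ + k) ω) ω‖ ≤ L * a (n₀ + k) := by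
    intro k
    have hk := ha.pos (n₀ + k)
    filter_upwards [norm_martingaleNoise_le hmod hit hR0 (hn.trans (Nat.le_add_right n₀ k))]
      with ω hω
    by_cases hωS : ω ∈ staySet θ θstar r n₀ k
    · rw [Set.indicator_of_mem hωS, norm_smul, Real.norm_of_nonneg hk.le, mul_comm]
      exact mul_le_mul_of_nonneg_right ((hω (hSR k ω hωS)).trans hL) hk.le
    · rw [Set.indicator_of_notMem hωS, norm_zero]
      positivity
  have hzero : ∀ k, (cond μ G)[(staySet θ θstar r n₀ k).indicator
      (fun ω => a (n₀ + k) • martingaleNoise f Γ v θ Y M (n₀ + k) ω) | ℱ (n₀ + k)]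
        =ᵐ[cond μ G] 0 := by
    intro k
    refine condExp_cond_eq_zero (ℱ.le _) (ℱ.mono (Nat.le_add_right n₀ k) _ hG) hμG
      (Integrable.of_bound ((hmeas k).mono (ℱ.le _) le_rfl).aestronglyMeasurable _ (hbd k)) ?_
    have e : (staySet θ θstar r n₀ k).indicator
        (fun ω => a (n₀ + k) • martingaleNoise f Γ v θ Y M (n₀ + k) ω)
        = a (n₀ + k) • (staySet θ θstar r n₀ k).indicator
          (martingaleNoise f Γ v θ Y M (n₀ + k)) := by
      ext1 ω
      by_cases hωS : ω ∈ staySet θ θstar r n₀ k <;> simp [hωS]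
    rw [e]
    filter_upwards [condExp_smul (μ := μ) (a (n₀ + k)) ((staySet θ θstar r n₀ k).indicator
        (martingaleNoise f Γ v θ Y M (n₀ + k))) (ℱ (n₀ + k)),
      condExp_indicator_martingaleNoise hmod hit hu hR0 (hn.trans (Nat.le_add_right n₀ k))
        (hS k) (hSR k)] with ω h1 h2
    rw [h1, Pi.smul_apply, h2]
    simp
  have hs := tailSq_pos ha n₀
  -- The indicator at index k is known at time n₀ + k, so stopping preserves the martingale
  -- differences.
  refine measure_exists_norm_partialSum_ge_le (𝒢 := shiftFiltration ℱ n₀)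
    (b := fun k => L * a (n₀ + k)) hmeas (fun k => mul_pos hL0 (ha.pos _))
    (fun k => hac.ae_le (hbd k)) hzero hδ (by positivity) fun n => ?_
  simp_rw [mul_pow, ← Finset.mul_sum]
  exact mul_le_mul_of_nonneg_left (sum_sq_le_tailSq ha n₀ n) (sq_nonneg L)

/-- With the deviation bound at level `γ`, the iterates started near `θstar` stay within `2ε` of it
forever with conditional probability at least `1 - γ`. -/
lemma one_sub_le_cond_forall_norm_sub_lt [IsProbabilityMeasure μ] (hmod : IsNoiseModel f κ Γ v K CR)
    (hit : IsFixedPointIteration μ ℱ a f κ θ Y M K' Cbar n₁) (ha : IsStepSize a) (hCbar : 0 < Cbar)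
    {α ε γ L : ℝ} {θstar : Vec d} (hα0 : 0 < α) (hα1 : α < 1) (hε : 0 < ε) (hγ : 0 ≤ γ)
    (hu : ∀ x y, ‖avgMap f Γ x - avgMap f Γ y‖ ≤ α * ‖x - y‖) (hfix : avgMap f Γ θstar = θstar)
    (hR : ‖θstar‖ + 2 * ε ≤ R) (hL0 : 0 < L)
    (hL : |K'| * (1 + R) + 2 * (|CR R| * (1 + Cbar)) + 2 * (|K| * (1 + R)) ≤ L)
    {n₀ : ℕ} (hn : n₁ ≤ n₀) (ha1 : a n₀ ≤ 1)
    (hsmall : 2 * a n₀ * (|CR R| * (1 + Cbar)) + |CR R| * (1 + Cbar)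
        * (|K| * (1 + R) + R + |K'| * (1 + R)) * tailSq a n₀ ≤ (1 - α) * ε / 8)
    (hexp : 2 * d * Real.exp (-(((1 - α) * ε / 8) ^ 2 / (2 * d * (L ^ 2 * tailSq a n₀)))) ≤ γ)
    (hμG : μ {ω | θ n₀ ω ∈ Metric.ball θstar (3 * ε / 2)} ≠ 0) :
    1 - γ ≤ (cond μ {ω | θ n₀ ω ∈ Metric.ball θstar (3 * ε / 2)}).real
      {ω | ∀ n, n₀ ≤ n → ‖θ n ω - θstar‖ < 2 * ε} := by
  have hR0 : 0 < R := by
    have := norm_nonneg θstar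
    linarith
  have hα : 0 < 1 - α := sub_pos.2 hα1
  have hG : MeasurableSet[ℱ n₀] {ω | θ n₀ ω ∈ Metric.ball θstar (3 * ε / 2)} :=
    hit.measurable_θ n₀ measurableSet_ball
  have := cond_isProbabilityMeasure hμG
  have hac : cond μ {ω | θ n₀ ω ∈ Metric.ball θstar (3 * ε / 2)} ≪ μ := cond_absolutelyContinuous
  have hucont : Continuous (avgMap f Γ) :=
    (LipschitzWith.of_dist_le_mul (K := α.toNNReal) fun x y => by
      simpa [dist_eq_norm, hα0.le] using hu x y).continuous
  have hbad := (cond_measure_martingaleNoise_le hmod hit ha hucont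
    (δ := (1 - α) * ε / 8) (r := 2 * ε) (by positivity) hR0 hR hL0 hL hn hG hμG).trans
    (ENNReal.ofReal_le_ofReal hexp)
  set E : Set Ω := {ω | ∀ n, n₀ ≤ n → ‖θ n ω - θstar‖ < 2 * ε}
    with hE
  have hEm : MeasurableSet E := by
    have e : E = ⋂ n, ⋂ (_ : n₀ ≤ n),
        θ n ⁻¹' Metric.ball θstar (2 * ε) := by
      ext ω
      simp [E, dist_eq_norm]
    rw [e]
    exact MeasurableSet.iInter fun n => MeasurableSet.iInter fun _ =>
      ((hit.measurable_θ n).mono (ℱ.le n) le_rfl) measurableSet_ball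
  have hEc : cond μ {ω | θ n₀ ω ∈ Metric.ball θstar (3 * ε / 2)} Eᶜ ≤ ENNReal.ofReal γ := by
    refine (measure_mono_ae ?_).trans hbad
    filter_upwards [hac.ae_le (ae_all_iff.2 fun j => hit.bounded_Y (n₀ + j)
        (hn.trans (Nat.le_add_right n₀ j))),
      hac.ae_le (ae_all_iff.2 fun j => hit.bounded_M (n₀ + j)),
      ae_cond_mem (ℱ.le _ _ hG)] with ω hY hM hωG hωE
    by_contra hω
    refine hωE fun n hnle => ?_
    obtain ⟨k, rfl⟩ := Nat.exists_eq_add_of_le hnle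
    refine norm_iterate_sub_lt_of_martingaleNoise hmod hit ha hCbar hα0 hα1 hε hu hfix hR ha1
      hsmall hY hM (mem_ball_iff_norm.1 hωG).le (fun k hk => ?_) k
    -- Before exit every indicator equals 1, so the stopped sum is the true one.
    have hlt : ‖∑ k ∈ Finset.range k, (staySet θ θstar (2 * ε) n₀ k).indicator
        (fun ω => a (n₀ + k) • martingaleNoise f Γ v θ Y M (n₀ + k) ω) ω‖ < (1 - α) * ε / 8 :=
      not_le.1 fun h => hω ⟨k, h⟩
    refine le_of_eq_of_le ?_ hlt.le
    congr 1
    refine Finset.sum_congr rfl fun j hj => ?_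
    rw [Set.indicator_of_mem]
    exact fun i hi => hk i (hi.trans_lt (Finset.mem_range.1 hj))
  have h1 : (cond μ {ω | θ n₀ ω ∈ Metric.ball θstar (3 * ε / 2)}).real Eᶜ ≤ γ := ENNReal.toReal_le_of_le_ofReal hγ hEc
  rw [probReal_compl_eq_one_sub hEm] at h1
  linarith

end Iteration

/-! ### Choice of constants and conclusion. -/

lemma two_mul_exp_neg_le {d : ℕ} {γ δ L s : ℝ} (hd : 0 < d) (hγ : 0 < γ) (hL : 0 < L)
    (hs : 0 < s) (h : Real.log (4 * d / γ) * (2 * d * (L ^ 2 * s)) ≤ δ ^ 2) :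
    2 * d * Real.exp (-(δ ^ 2 / (2 * d * (L ^ 2 * s)))) ≤ γ := by
  have hd' : (0 : ℝ) < d := Nat.cast_pos.2 hd
  have h1 : Real.log (4 * d / γ) ≤ δ ^ 2 / (2 * d * (L ^ 2 * s)) := by
    rwa [le_div_iff₀ (by positivity)]
  calc _ ≤ 2 * d * Real.exp (-Real.log (4 * d / γ)) := by gcongr
    _ = γ / 2 := by
      rw [Real.exp_neg, Real.exp_log (by positivity)]
      field_simp
      norm_num
    _ ≤ γ := by linarith

theorem mainTheorem6 (d : ℕ) (K K' Cbar α T εmax : ℝ) (CR : ℝ → ℝ) (θstar : Vec d)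
    (hCbar : 0 < Cbar) (hα0 : 0 < α) (hα1 : α < 1) (hT : 0 < T) (hεmax : 0 < εmax) :
    ∃ c Chat η : ℝ, 0 < c ∧ 0 < Chat ∧ 0 < η ∧
      ∀ (Ω : Type*) [MeasurableSpace Ω] (μ : Measure Ω) [IsProbabilityMeasure μ]
        (ℱ : Filtration ℕ (inferInstance : MeasurableSpace Ω))
        (a : ℕ → ℝ) (f : Vec d → Vec d → Vec d) (κ : Kernel (Vec d × Vec d) (Vec d))
        (Γ : Vec d → Measure (Vec d)) (v : Vec d → Vec d → Vec d)
        (θ Y M : ℕ → Ω → Vec d) (n₁ n₀ : ℕ) (ε γ : ℝ),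
        IsStepSize a →
        IsNoiseModel f κ Γ v K CR →
        IsFixedPointIteration μ ℱ a f κ θ Y M K' Cbar n₁ →
        (∀ x y, ‖avgMap f Γ x - avgMap f Γ y‖ ≤ α * ‖x - y‖) →
        avgMap f Γ θstar = θstar →
        0 < ε → ε ≤ εmax → 0 < γ → γ < 1 →
        n₁ ≤ n₀ →
        a n₀ < η * ε → tailSq a n₀ < η * ε →
        tailSq a n₀ < Chat * ε ^ 2 / 4 → a n₀ < Chat * ε ^ 2 / 4 →
        tailSq a n₀ < c * ε ^ 2 / Real.log (4 * d / γ) →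
        μ {ω | θ n₀ ω ∈ Metric.ball θstar (3 * ε / 2)} ≠ 0 →
        1 - γ ≤ (cond μ {ω | θ n₀ ω ∈ Metric.ball θstar (3 * ε / 2)}).real
          {ω | ∀ n, n₀ + sampleComplexity a α T n₀ ≤ n → ‖θ n ω - θstar‖ < 2 * ε} := by
  -- Using `εmax` instead of ε keeps all constants independent of ε.
  set R : ℝ := ‖θstar‖ + 2 * εmax with hRdef
  have hR0 : 0 < R := by positivity
  set V : ℝ := |CR R| * (1 + Cbar) with hV
  have hV0 : 0 ≤ V := by positivity
  set W : ℝ := |K| * (1 + R) + R + |K'| * (1 + R) with hW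
  have hW0 : 0 ≤ W := by positivity
  set L : ℝ := |K'| * (1 + R) + 2 * V + 2 * (|K| * (1 + R)) + 1 with hLdef
  have hL0 : 0 < L := by positivity
  have hα : 0 < 1 - α := sub_pos.2 hα1
  -- The factor 128 is 64 from ((1-α)ε/8)² times 2 from the Azuma exponent; d + 1 keeps c meaningful
  -- for d = 0. In η, the first entry bounds the Poisson correction and the second gives a(n₀) ≤ 1.
  refine ⟨(1 - α) ^ 2 / (128 * (d + 1) * L ^ 2), 1,
    min ((1 - α) / (8 * (2 * V + V * W + 1))) (1 / εmax), by positivity, one_pos,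
    lt_min (by positivity) (by positivity), ?_⟩
  intro Ω _ μ _ ℱ a f κ Γ v θ Y M n₁ n₀ ε γ ha hmod hit hu hfix hε hεle hγ0 hγ1 hn han hsn
    _ _ hslog hμG
  set η : ℝ := min ((1 - α) / (8 * (2 * V + V * W + 1))) (1 / εmax) with hη
  have hs0 := tailSq_pos ha n₀
  -- For d = 0, `Real.log 0 = 0` and division by zero yields 0, so `hslog` would make the tail sum
  -- negative.
  have hd : 0 < d := by
    rcases Nat.eq_zero_or_pos d with rfl | hd
    · simp at hslog
      linarith
    · exact hd
  have hd' : (1 : ℝ) ≤ d := Nat.one_le_cast.2 hd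
  have hRε : ‖θstar‖ + 2 * ε ≤ R := by linarith
  have ha1 : a n₀ ≤ 1 := by
    have h1 : η * ε ≤ 1 / εmax * εmax := by
      gcongr
      exact min_le_right _ _
    rw [one_div_mul_cancel hεmax.ne'] at h1
    exact han.le.trans h1
  have hsmall : 2 * a n₀ * V + V * W * tailSq a n₀ ≤ (1 - α) * ε / 8 := by
    have h1 : η ≤ (1 - α) / (8 * (2 * V + V * W + 1)) := min_le_left _ _
    rw [le_div_iff₀ (by positivity)] at h1
    have hη0 : 0 < η := lt_min (by positivity) (by positivity)
    have h2 : 2 * a n₀ * V ≤ 2 * (η * ε) * V := by gcongr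
    have h3 : V * W * tailSq a n₀ ≤ V * W * (η * ε) := by gcongr
    have h4 := mul_le_mul_of_nonneg_right h1 hε.le
    linarith [mul_pos hη0 hε]
  have hlog : 0 < Real.log (4 * d / γ) :=
    Real.log_pos ((one_lt_div hγ0).2 (by linarith))
  have hexp : Real.log (4 * d / γ) * (2 * d * (L ^ 2 * tailSq a n₀))
      ≤ ((1 - α) * ε / 8) ^ 2 := by
    rw [lt_div_iff₀ hlog] at hslog
    calc _ = tailSq a n₀ * Real.log (4 * d / γ) * (2 * d * L ^ 2) := by ring
      _ ≤ (1 - α) ^ 2 / (128 * (d + 1) * L ^ 2) * ε ^ 2 * (2 * d * L ^ 2) := by gcongr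
      _ = ((1 - α) * ε / 8) ^ 2 * (d / (d + 1)) := by
        field_simp
        ring
      _ ≤ ((1 - α) * ε / 8) ^ 2 * 1 := by
        gcongr
        exact (div_le_one (by positivity)).2 (by linarith)
      _ = _ := mul_one _
  refine (one_sub_le_cond_forall_norm_sub_lt hmod hit ha hCbar hα0 hα1 hε hγ0.le hu hfix hRε hL0
    (by linarith) hn ha1 hsmall (two_mul_exp_neg_le hd hγ0 hL0 hs0 hexp) hμG).trans
    (measureReal_mono fun ω hω n hnle => hω n ((Nat.le_add_right _ _).trans hnle))
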